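/- Let $(\mathfrak H,(\cdot,\cdot))$ be a complex Hilbert space, let $J$ be a non-trivial fundamental symmetry ($J=J^*$, $J^2=I$, $J\neq\pm I$) and let $[x,y]=(Jx,y)$. Let $H$ be a $J$-symmetric operator in $\mathfrak H$ (that is, $[Hx,y]=[x,Hy]$ for all $x,y\in D(H)$) with eigenvectors $\{f_n\}_{n=1}^\infty$ corresponding to distinct real simple eigenvalues $\lambda_n$, and suppose that $\{f_n\}$ is complete, i.e. its linear span is dense in $\mathfrak H$. Let $\mathfrak L^0_+$ and $\mathfrak L^0_-$ be the closures in $\mathfrak H$ of the linear spans of $\{f_n:[f_n,f_n]>0\}$ and $\{f_n:[f_n,f_n]<0\}$, respectively. Define $\mathcal C_0(a+b)=a-b$ for $a\in\mathfrak L^0_+$, $b\in\mathfrak L^0_-$, with domain $\mathfrak L_+^0\dot+\mathfrak L_-^0$, and set $G_0=J\mathcal C_0$; this is a densely defined positive symmetric operator. Let $D[G_0]\subset\mathfrak H$ be the closure of $D(G_0)$ with respect to the norm $\|x\|_0^2=\|x\|^2+(G_0x,x)$, and let $G_F$, the Friedrichs extension of $G_0$, be the restriction of $G_0^*$ to $D[G_0]\cap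 D(G_0^*)$. An operator $\mathcal C$ in $\mathfrak H$ is called an operator of $\mathcal C$-symmetry if $\mathcal C^2x=x$ for all $x\in D(\mathcal C)$ and $J\mathcal C$ is a positive self-adjoint operator; in this case $\mathfrak H_{\mathcal C}$ denotes the Hilbert space completion of $D(\mathcal C)$ with respect to the inner product $(x,y)_{\mathcal C}=[\mathcal Cx,y]$. Suppose that the operator $\mathcal C=JG_F$ is determined by the Friedrichs extension, in the sense that $JG_F$ is an operator of $\mathcal C$-symmetry, or in the sense that $$\inf_{x\in D(G_0)\setminus\{0\}}\frac{(G_0x,x)}{|(x,g)|^2}=0\qquad\text{for all nonzero } g\in\ker(I+G_0^*)$$ (the quotient being $+\infty$ when $(x,g)=0$). Then $\mathcal C=JG_F$ is an operator of $\mathcal C$-symmetry extending $\mathcal C_0$, and the linear span of $\{f_n\}$ is dense in $\mathfrak H_{\mathcal C}$. -/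

import Mathlib

open Filter Topology
open scoped InnerProductSpace LinearPMap

noncomputable section

namespace KreinCSymmetry

variable {H : Type*} [NormedAddCommGroup H] [InnerProductSpace ℂ H]

/-- The product of a bounded everywhere defined operator and a partially defined operator,
`D(B A) = D(A)` and `(B A) x = B (A x)`. -/
def leftMul (B : H →L[ℂ] H) (A : H →ₗ.[ℂ] H) : H →ₗ.[ℂ] H :=
  (B : H →ₗ[ℂ] H).compPMap A

/-- A non-trivial fundamental symmetry: `J = J*`, `J² = I`, `J ≠ I`, `J ≠ -I`. -/
structure IsFundamentalSymmetry (J : H →L[ℂ] H) : Prop where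
  selfAdjoint : ∀ x y : H, ⟪J x, y⟫_ℂ = ⟪x, J y⟫_ℂ
  involutive : ∀ x : H, J (J x) = x
  ne_id : J ≠ ContinuousLinearMap.id ℂ H
  ne_neg_id : J ≠ -ContinuousLinearMap.id ℂ H

/-- The indefinite inner product `[x, y] = (J x, y)`, linear in `x`.  (Mathlib's `⟪·, ·⟫_ℂ` is
linear in the second argument, so `(x, y) = ⟪y, x⟫_ℂ`.) -/
def kreinInner (J : H →L[ℂ] H) (x y : H) : ℂ := ⟪y, J x⟫_ℂ

/-- A `J`-symmetric operator `T` in the Krein space given by `J`, together with a complete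
sequence of eigenvectors `f n` (the linear span is dense) corresponding to real simple
eigenvalues `ev n`. -/
structure IsCompleteEigensystem (J : H →L[ℂ] H) (T : H →ₗ.[ℂ] H) (ev : ℕ → ℝ) (f : ℕ → H) :
    Prop where
  fundamental : IsFundamentalSymmetry J
  jSymmetric : ∀ x y : T.domain, kreinInner J (T x) y = kreinInner J x (T y)
  ne_zero : ∀ n, f n ≠ 0
  mem_domain : ∀ n, f n ∈ T.domain
  eigen : ∀ n, T ⟨f n, mem_domain n⟩ = (ev n : ℂ) • f n
  ev_injective : Function.Injective ev
  simple : ∀ n, ∀ x : T.domain, T x = (ev n : ℂ) • (x : H) → (x : H) ∈ Submodule.span ℂ {f n}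
  complete : Dense (Submodule.span ℂ (Set.range f) : Set H)

/-- The closure `𝔏₊⁰` of the linear span of the eigenvectors with `[f n, f n] > 0`. -/
def posSpan (J : H →L[ℂ] H) (f : ℕ → H) : Submodule ℂ H :=
  (Submodule.span ℂ (f '' {n | 0 < (kreinInner J (f n) (f n)).re})).topologicalClosure

/-- The closure `𝔏₋⁰` of the linear span of the eigenvectors with `[f n, f n] < 0`. -/
def negSpan (J : H →L[ℂ] H) (f : ℕ → H) : Submodule ℂ H :=
  (Submodule.span ℂ (f '' {n | (kreinInner J (f n) (f n)).re < 0})).topologicalClosure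

/-- The operator `a + b ↦ a - b` (`a ∈ L₊`, `b ∈ L₋`) on the direct sum `L₊ ∔ L₋`. -/
def sumInvolution (Lp Lm : Submodule ℂ H) (h : Disjoint Lp Lm) : H →ₗ.[ℂ] H :=
  LinearPMap.sup ⟨Lp, Lp.subtype⟩ ⟨Lm, -Lm.subtype⟩ (LinearPMap.sup_h_of_disjoint _ _ h)

/-- A densely defined, symmetric, nonnegative operator. -/
structure IsNonnegSymmetric (S : H →ₗ.[ℂ] H) : Prop where
  dense : Dense (S.domain : Set H)
  symm : ∀ x y : S.domain, ⟪S x, (y : H)⟫_ℂ = ⟪(x : H), S y⟫_ℂ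
  nonneg : ∀ x : S.domain, 0 ≤ (⟪(x : H), S x⟫_ℂ).re

/-- `C` is an operator of `𝒞`-symmetry in the Krein space given by `J`: `C² x = x` for all
`x ∈ D(C)` and `J C` is a positive self-adjoint operator. -/
structure IsCOperator [CompleteSpace H] (J : H →L[ℂ] H) (C : H →ₗ.[ℂ] H) : Prop where
  mapsTo : ∀ x : C.domain, C x ∈ C.domain
  sq_eq : ∀ x : C.domain, C ⟨C x, mapsTo x⟩ = x
  selfAdjoint : IsSelfAdjoint (leftMul J C)
  positive : ∀ x : C.domain, x ≠ 0 → 0 < (kreinInner J (C x) x).re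

/-! ### The pre-Hilbert space `(D(C), [C·, ·])` and its completion -/

/-- The domain of `C`, to be endowed with the inner product `[C·, ·]`. -/
def PreHilbert [CompleteSpace H] {J : H →L[ℂ] H} {C : H →ₗ.[ℂ] H} (_hC : IsCOperator J C) :
    Type _ := C.domain

section PreHilbert

variable [CompleteSpace H] {J : H →L[ℂ] H} {C : H →ₗ.[ℂ] H} (hC : IsCOperator J C)

instance : AddCommGroup (PreHilbert hC) := inferInstanceAs (AddCommGroup C.domain)

instance : Module ℂ (PreHilbert hC) := inferInstanceAs (Module ℂ C.domain)

/-- The inner product `(x, y)_C = [C x, y]`, written `⟪y, x⟫` in Mathlib's convention. -/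
@[reducible] def preHilbertCore : InnerProductSpace.Core ℂ (PreHilbert hC) where
  inner y x := kreinInner J (C (x : C.domain)) (Submodule.subtype C.domain y)
  conj_inner_symm := by
    intro (x : C.domain) (y : C.domain)
    have hsa := LinearPMap.isSelfAdjoint_def.1 hC.selfAdjoint
    have hd : Dense ((leftMul J C).domain : Set H) := hC.selfAdjoint.dense_domain
    have hf := LinearPMap.adjoint_isFormalAdjoint (T := leftMul J C) hd
    rw [hsa] at hf
    have h1 : ⟪J (C x), (y : H)⟫_ℂ = ⟪(x : H), J (C y)⟫_ℂ := hf x y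
    simp only [kreinInner]
    rw [inner_conj_symm]
    exact h1
  re_inner_nonneg := by
    intro (x : C.domain)
    by_cases hx : x = 0
    · subst hx
      simp [kreinInner]
    · exact (hC.positive x hx).le
  add_left := by
    intro (x : C.domain) (y : C.domain) (z : C.domain)
    exact inner_add_left (x : H) (y : H) _
  smul_left := by
    intro (x : C.domain) (y : C.domain) r
    exact inner_smul_left (x : H) _ r
  definite := by
    intro (x : C.domain) hx
    by_contra hne
    have h1 := hC.positive x hne
    have h2 : kreinInner J (C x) x = 0 := hx
    rw [h2] at h1
    simp at h1

instance : NormedAddCommGroup (PreHilbert hC) :=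
  (preHilbertCore hC).toNormedAddCommGroup

instance : InnerProductSpace ℂ (PreHilbert hC) :=
  InnerProductSpace.ofCore (preHilbertCore hC).toCore

/-- The Hilbert space `ℌ_C`: the completion of `(D(C), [C·, ·])`. -/
abbrev HilbertC : Type _ := UniformSpace.Completion (PreHilbert hC)

/-- The canonical embedding of `D(C)` into `ℌ_C`. -/
def toHilbertC (x : C.domain) : HilbertC hC :=
  UniformSpace.Completion.coe' (show PreHilbert hC from x)

theorem inner_toHilbertC (x y : C.domain) :
    ⟪toHilbertC hC y, toHilbertC hC x⟫_ℂ = kreinInner J (C x) y :=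
  UniformSpace.Completion.inner_coe (𝕜 := ℂ) (E := PreHilbert hC) y x

end PreHilbert

/-! ### The Friedrichs extension -/

section Friedrichs

variable {S : H →ₗ.[ℂ] H}

theorem IsNonnegSymmetric.form_add_le (hS : IsNonnegSymmetric S) (x y : S.domain) :
    (⟪((x + y : S.domain) : H), S (x + y)⟫_ℂ).re ≤
      2 * (⟪(x : H), S x⟫_ℂ).re + 2 * (⟪(y : H), S y⟫_ℂ).re := by
  have h := hS.nonneg (x - y)
  simp only [LinearPMap.map_add, LinearPMap.map_sub, Submodule.coe_add, Submodule.coe_sub,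
    inner_add_left, inner_add_right, inner_sub_left, inner_sub_right, Complex.add_re,
    Complex.sub_re] at h ⊢
  linarith

/-- The form domain `D[S]`: the closure of `D(S)` with respect to the norm
`‖x‖² + (S x, x)`, as a subspace of `H`. -/
def formDomain (hS : IsNonnegSymmetric S) : Submodule ℂ H where
  carrier := {x | ∃ u : ℕ → S.domain, Tendsto (fun n => (u n : H)) atTop (𝓝 x) ∧
    Tendsto (fun p : ℕ × ℕ => (⟪((u p.1 - u p.2 : S.domain) : H), S (u p.1 - u p.2)⟫_ℂ).re)
      atTop (𝓝 0)}
  zero_mem' := ⟨fun _ => 0, by simp, by simp⟩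
  add_mem' := by
    rintro x y ⟨u, hu, hu'⟩ ⟨v, hv, hv'⟩
    refine ⟨fun n => u n + v n, by simpa using hu.add hv, ?_⟩
    have h := (hu'.const_mul 2).add (hv'.const_mul 2)
    simp only [mul_zero, add_zero] at h
    refine squeeze_zero (fun p => hS.nonneg _) (fun p => ?_) h
    rw [add_sub_add_comm]
    exact hS.form_add_le _ _
  smul_mem' := by
    rintro c x ⟨u, hu, hu'⟩
    refine ⟨fun n => c • u n, by simpa using hu.const_smul c, ?_⟩
    have h := hu'.const_mul (‖c‖ ^ 2)
    rw [mul_zero] at h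
    refine h.congr fun p => ?_
    rw [← smul_sub, LinearPMap.map_smul, Submodule.coe_smul, inner_smul_left, inner_smul_right,
      ← mul_assoc, mul_comm ((starRingEnd ℂ) c), Complex.mul_conj, Complex.re_ofReal_mul,
      Complex.normSq_eq_norm_sq]

/-- The Friedrichs extension: the restriction of the adjoint `S*` to `D[S] ∩ D(S*)`. -/
def friedrichs [CompleteSpace H] (hS : IsNonnegSymmetric S) : H →ₗ.[ℂ] H :=
  LinearPMap.domRestrict (S†) (formDomain hS)

theorem le_friedrichs [CompleteSpace H] (hS : IsNonnegSymmetric S) : S ≤ friedrichs hS := by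
  have hle : S ≤ S† :=
    LinearPMap.IsFormalAdjoint.le_adjoint hS.dense fun x y => hS.symm x y
  have hform : S.domain ≤ formDomain hS := fun x hx =>
    ⟨fun _ => ⟨x, hx⟩, tendsto_const_nhds, by simp⟩
  refine ⟨fun x hx => ⟨hform hx, hle.1 hx⟩, ?_⟩
  intro x y hxy
  rw [hle.2 (x := x) (y := ⟨x, hle.1 x.2⟩) rfl]
  exact (LinearPMap.domRestrict_apply (f := S†) hxy.symm).symm

/-- For all nonzero `g ∈ ker (I + S*)`, the infimum of `(S x, x) / |(x, g)|²` over nonzero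
`x ∈ D(S)` vanishes.  The quotient is taken in `[0, ∞]`, so that for a strictly positive `S` it
equals `∞` whenever `(x, g) = 0`. -/
def KreinCondition [CompleteSpace H] (S : H →ₗ.[ℂ] H) : Prop :=
  ∀ g : S†.domain, g ≠ 0 → (g : H) + S† g = 0 →
    ⨅ (x : S.domain) (_ : x ≠ 0),
      ENNReal.ofReal (⟪(x : H), S x⟫_ℂ).re / ENNReal.ofReal (‖⟪(g : H), (x : H)⟫_ℂ‖ ^ 2) = 0

end Friedrichs

/-! ### The operators attached to a complete system of eigenvectors -/

theorem re_inner_nonneg_of_mem_closure_span (A : H →L[ℂ] H) (f : ℕ → H) (s : Set ℕ)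
    (horth : ∀ m n, m ≠ n → ⟪f m, A (f n)⟫_ℂ = 0) (hs : ∀ n ∈ s, 0 ≤ (⟪f n, A (f n)⟫_ℂ).re)
    {x : H} (hx : x ∈ (Submodule.span ℂ (f '' s)).topologicalClosure) :
    0 ≤ (⟪x, A x⟫_ℂ).re := by
  have hcl : IsClosed {x : H | 0 ≤ (⟪x, A x⟫_ℂ).re} :=
    isClosed_le continuous_const (by fun_prop)
  have hsub : (Submodule.span ℂ (f '' s) : Set H) ⊆ {x : H | 0 ≤ (⟪x, A x⟫_ℂ).re} := by
    intro y hy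
    obtain ⟨l, hl, rfl⟩ := (Finsupp.mem_span_image_iff_linearCombination ℂ).1 hy
    rw [Set.mem_ofPred_eq, Finsupp.linearCombination_apply, Finsupp.sum, map_sum, sum_inner,
      Complex.re_sum]
    refine Finset.sum_nonneg fun i hi => ?_
    rw [inner_sum, Finset.sum_eq_single i]
    · rw [map_smul, inner_smul_left, inner_smul_right, ← mul_assoc,
        mul_comm ((starRingEnd ℂ) (l i)), Complex.mul_conj, Complex.re_ofReal_mul]
      exact mul_nonneg (Complex.normSq_nonneg _) (hs i (hl hi))
    · intro j _ hj
      rw [map_smul, inner_smul_left, inner_smul_right, horth i j hj.symm]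
      simp
    · intro h
      exact absurd hi h
  exact closure_minimal hsub hcl hx

namespace IsCompleteEigensystem

variable {J : H →L[ℂ] H} {T : H →ₗ.[ℂ] H} {ev : ℕ → ℝ} {f : ℕ → H}

theorem orth (h : IsCompleteEigensystem J T ev f) (m n : ℕ) (hmn : m ≠ n) :
    ⟪f m, J (f n)⟫_ℂ = 0 := by
  have h1 := h.jSymmetric ⟨f n, h.mem_domain n⟩ ⟨f m, h.mem_domain m⟩
  rw [h.eigen, h.eigen] at h1
  simp only [kreinInner, map_smul, inner_smul_left, inner_smul_right, Complex.conj_ofReal] at h1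
  have h2 : ((ev n : ℂ) - ev m) * ⟪f m, J (f n)⟫_ℂ = 0 := by rw [sub_mul, h1, sub_self]
  rcases mul_eq_zero.1 h2 with h3 | h3
  · exact absurd (h.ev_injective (Complex.ofReal_injective (sub_eq_zero.1 h3))).symm hmn
  · exact h3

theorem eq_zero_of_orth (h : IsCompleteEigensystem J T ev f) {x : H}
    (hx : ∀ n, ⟪f n, J x⟫_ℂ = 0) : x = 0 := by
  have h1 : J x = 0 := by
    refine h.complete.eq_zero_of_inner_right ℂ fun v hv => ?_
    have hle : Submodule.span ℂ (Set.range f) ≤ (ℂ ∙ (J x))ᗮ := by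
      rw [Submodule.span_le]
      rintro _ ⟨n, rfl⟩
      rw [SetLike.mem_coe, Submodule.mem_orthogonal_singleton_iff_inner_left]
      exact hx n
    exact Submodule.mem_orthogonal_singleton_iff_inner_left.1 (hle hv)
  rw [← h.fundamental.involutive x, h1, map_zero]

theorem kreinInner_self_ne_zero (h : IsCompleteEigensystem J T ev f) (n : ℕ) :
    (kreinInner J (f n) (f n)).re ≠ 0 := by
  intro h0
  have him : (⟪f n, J (f n)⟫_ℂ).im = 0 := by
    rw [← Complex.conj_eq_iff_im, inner_conj_symm]
    exact h.fundamental.selfAdjoint _ _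
  refine h.ne_zero n (h.eq_zero_of_orth fun m => ?_)
  by_cases hmn : m = n
  · subst hmn
    exact Complex.ext h0 him
  · exact h.orth m n hmn

theorem mem_posSpan_or_mem_negSpan (h : IsCompleteEigensystem J T ev f) (n : ℕ) :
    f n ∈ posSpan J f ∨ f n ∈ negSpan J f := by
  rcases (h.kreinInner_self_ne_zero n).lt_or_gt with hn | hn
  · exact Or.inr (Submodule.le_topologicalClosure _ (Submodule.subset_span ⟨n, hn, rfl⟩))
  · exact Or.inl (Submodule.le_topologicalClosure _ (Submodule.subset_span ⟨n, hn, rfl⟩))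

theorem posSpan_orth_negSpan (h : IsCompleteEigensystem J T ev f) {a b : H}
    (ha : a ∈ posSpan J f) (hb : b ∈ negSpan J f) : ⟪a, J b⟫_ℂ = 0 := by
  have h1 : ∀ m, 0 < (kreinInner J (f m) (f m)).re → negSpan J f ≤ (ℂ ∙ (J (f m)))ᗮ := by
    intro m hm
    refine Submodule.topologicalClosure_minimal _ ?_ (Submodule.isClosed_orthogonal _)
    rw [Submodule.span_le]
    rintro _ ⟨n, hn, rfl⟩
    rw [SetLike.mem_coe, Submodule.mem_orthogonal_singleton_iff_inner_left]
    refine h.orth n m ?_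
    rintro rfl
    exact lt_asymm hm hn
  have h2 : posSpan J f ≤ (ℂ ∙ (J b))ᗮ := by
    refine Submodule.topologicalClosure_minimal _ ?_ (Submodule.isClosed_orthogonal _)
    rw [Submodule.span_le]
    rintro _ ⟨m, hm, rfl⟩
    rw [SetLike.mem_coe, Submodule.mem_orthogonal_singleton_iff_inner_left,
      ← h.fundamental.selfAdjoint]
    exact Submodule.mem_orthogonal_singleton_iff_inner_right.1 (h1 m hm hb)
  exact Submodule.mem_orthogonal_singleton_iff_inner_left.1 (h2 ha)

theorem disjoint (h : IsCompleteEigensystem J T ev f) :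
    Disjoint (posSpan J f) (negSpan J f) := by
  rw [Submodule.disjoint_def]
  intro x hp hn
  refine h.eq_zero_of_orth fun n => ?_
  rcases h.mem_posSpan_or_mem_negSpan n with hf | hf
  · exact h.posSpan_orth_negSpan hf hn
  · rw [← h.fundamental.selfAdjoint, ← inner_conj_symm, h.posSpan_orth_negSpan hp hf, map_zero]

/-- The operator `𝒞₀` on `D(𝒞₀) = 𝔏₊⁰ ∔ 𝔏₋⁰`, equal to `I` on `𝔏₊⁰` and to `-I` on `𝔏₋⁰`. -/
def C₀ (h : IsCompleteEigensystem J T ev f) : H →ₗ.[ℂ] H :=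
  sumInvolution (posSpan J f) (negSpan J f) h.disjoint

/-- The operator `G₀ = J 𝒞₀`. -/
def G₀ (h : IsCompleteEigensystem J T ev f) : H →ₗ.[ℂ] H := leftMul J h.C₀

theorem exists_decomp (h : IsCompleteEigensystem J T ev f) (x : h.G₀.domain) :
    ∃ a ∈ posSpan J f, ∃ b ∈ negSpan J f, (x : H) = a + b ∧ h.G₀ x = J a - J b := by
  obtain ⟨x, hx⟩ := x
  obtain ⟨a, ha, b, hb, hab⟩ := Submodule.mem_sup.1 (show x ∈ posSpan J f ⊔ negSpan J f from hx)
  refine ⟨a, ha, b, hb, hab.symm, ?_⟩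
  have h1 : h.C₀ ⟨x, hx⟩ = a + -b :=
    LinearPMap.sup_apply
      (f := ⟨posSpan J f, (posSpan J f).subtype⟩) (g := ⟨negSpan J f, -(negSpan J f).subtype⟩)
      (LinearPMap.sup_h_of_disjoint _ _ h.disjoint) ⟨a, ha⟩ ⟨b, hb⟩ ⟨x, hx⟩ hab
  change J (h.C₀ ⟨x, hx⟩) = _
  rw [h1, ← sub_eq_add_neg, map_sub]

theorem mem_domain_G₀ (h : IsCompleteEigensystem J T ev f) (n : ℕ) : f n ∈ h.G₀.domain := by
  change f n ∈ posSpan J f ⊔ negSpan J f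
  rcases h.mem_posSpan_or_mem_negSpan n with hf | hf
  · exact Submodule.mem_sup_left hf
  · exact Submodule.mem_sup_right hf

theorem isNonnegSymmetric_G₀ (h : IsCompleteEigensystem J T ev f) :
    IsNonnegSymmetric h.G₀ where
  dense := by
    refine h.complete.mono ?_
    rw [SetLike.coe_subset_coe, Submodule.span_le]
    rintro _ ⟨n, rfl⟩
    exact h.mem_domain_G₀ n
  symm := by
    intro x y
    obtain ⟨a, ha, b, hb, hx, hGx⟩ := h.exists_decomp x
    obtain ⟨a', ha', b', hb', hy, hGy⟩ := h.exists_decomp y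
    rw [hGx, hGy, hx, hy]
    have e1 := h.posSpan_orth_negSpan ha hb'
    have e2 : ⟪b, J a'⟫_ℂ = 0 := by
      rw [← h.fundamental.selfAdjoint, ← inner_conj_symm, h.posSpan_orth_negSpan ha' hb, map_zero]
    simp only [inner_add_left, inner_add_right, inner_sub_left, inner_sub_right,
      h.fundamental.selfAdjoint, e1, e2]
    ring
  nonneg := by
    intro x
    obtain ⟨a, ha, b, hb, hx, hGx⟩ := h.exists_decomp x
    rw [hGx, hx]
    have e1 := h.posSpan_orth_negSpan ha hb
    have e2 : ⟪b, J a⟫_ℂ = 0 := by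
      rw [← h.fundamental.selfAdjoint, ← inner_conj_symm, e1, map_zero]
    have p1 : 0 ≤ (⟪a, J a⟫_ℂ).re :=
      re_inner_nonneg_of_mem_closure_span J f _ h.orth (fun n hn => le_of_lt hn) ha
    have p2 : 0 ≤ (⟪b, (-J) b⟫_ℂ).re := by
      refine re_inner_nonneg_of_mem_closure_span (-J) f
        {n | (kreinInner J (f n) (f n)).re < 0} (fun m n hmn => ?_) (fun n hn => ?_) hb
      · simp [h.orth m n hmn]
      · have hn' : (⟪f n, J (f n)⟫_ℂ).re < 0 := hn
        simpa using hn'.le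
    simp only [neg_apply, inner_neg_right, Complex.neg_re] at p2
    simp only [inner_add_left, inner_sub_right, e1, e2, Complex.add_re, Complex.sub_re,
      Complex.zero_re]
    linarith

variable [CompleteSpace H]

/-- The Friedrichs extension `G_F` of `G₀`. -/
def GF (h : IsCompleteEigensystem J T ev f) : H →ₗ.[ℂ] H := friedrichs h.isNonnegSymmetric_G₀

/-- The operator `𝒞_F = J G_F`. -/
def CF (h : IsCompleteEigensystem J T ev f) : H →ₗ.[ℂ] H := leftMul J h.GF

theorem mem_domain_CF (h : IsCompleteEigensystem J T ev f) (n : ℕ) : f n ∈ h.CF.domain :=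
  (le_friedrichs h.isNonnegSymmetric_G₀).1 (h.mem_domain_G₀ n)

end IsCompleteEigensystem

end KreinCSymmetry

end

open Filter Topology
open scoped InnerProductSpace LinearPMap

noncomputable section

namespace KreinCSymmetry

variable {H : Type*} [NormedAddCommGroup H] [InnerProductSpace ℂ H]

/-! ### The form of a nonnegative symmetric operator and of its Friedrichs extension -/

section Form

variable {S : H →ₗ.[ℂ] H}

/-! Self-adjointness of `G_F` is classical: the Riesz theorem in the form space makes `I + G_F`
onto, and a symmetric operator with this property is self-adjoint. What needs the Krein condition is
`(J G_F)² = I`. On `D(G₀)` one has `G₀ J G₀ = J`, so `J G_F⁻¹ J` is formally another nonnegative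
extension of `G₀`. Given `b` in `D(G_F)`, solve `w + G_F w = J (b + G_F b)`; then `J G_F w - b` lies
in `ker (I + G₀*)`, and pairing it with `G₀ x` gives a functional bounded in the form of `G₀`
(`exists_GF_apply_eq`). On that kernel `(x, g) = -(G₀ x, g)`, so such a bound keeps the quotient of
the Krein condition away from `0` unless the vector vanishes (`KreinCondition.eq_zero`). Hence `w =
J G_F b` and `G_F w = J b`.

Density uses only that `J G_F` is an operator of `𝒞`-symmetry. The squared norm of `ℌ_C` on the
domain is the form of `G_F`. In this form `D(G₀)` is dense in `D(G_F)`, and on the two closed spans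
`G_F` equals `J` and `-J`, which are bounded, so approximation in `H` within each span is
approximation in the form (`exists_span_range_form_lt`). -/

/-- The positive semidefinite form `(S x, y)` on the domain of `S`. -/
@[reducible] def IsNonnegSymmetric.formCore (hS : IsNonnegSymmetric S) :
    PreInnerProductSpace.Core ℂ S.domain where
  inner x y := ⟪(x : H), S y⟫_ℂ
  conj_inner_symm x y := by
    rw [inner_conj_symm]
    exact hS.symm x y
  re_inner_nonneg x := hS.nonneg x
  add_left _ _ _ := inner_add_left _ _ _
  smul_left _ _ _ := inner_smul_left _ _ _

/-- The Cauchy–Schwarz inequality for the form `(S x, y)`. -/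
theorem IsNonnegSymmetric.norm_form_sq_le (hS : IsNonnegSymmetric S) (x y : S.domain) :
    ‖⟪(x : H), S y⟫_ℂ‖ ^ 2 ≤ (⟪(x : H), S x⟫_ℂ).re * (⟪(y : H), S y⟫_ℂ).re := by
  have h := @InnerProductSpace.Core.inner_mul_inner_self_le ℂ S.domain _ _ _ hS.formCore x y
  have e : ‖⟪(y : H), S x⟫_ℂ‖ = ‖⟪(x : H), S y⟫_ℂ‖ := by
    rw [← hS.symm, norm_inner_symm]
  have h' : ‖⟪(x : H), S y⟫_ℂ‖ * ‖⟪(y : H), S x⟫_ℂ‖ ≤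
      (⟪(x : H), S x⟫_ℂ).re * (⟪(y : H), S y⟫_ℂ).re := h
  rwa [e, ← sq] at h'

theorem IsNonnegSymmetric.form_im (hS : IsNonnegSymmetric S) (x : S.domain) :
    (⟪(x : H), S x⟫_ℂ).im = 0 := by
  rw [← Complex.conj_eq_iff_im, inner_conj_symm]
  exact hS.symm x x

/-- By Cauchy–Schwarz for the form, `S x` is orthogonal to the dense domain of `S`. -/
theorem IsNonnegSymmetric.apply_eq_zero (hS : IsNonnegSymmetric S) {x : S.domain}
    (hx : (⟪(x : H), S x⟫_ℂ).re = 0) : S x = 0 := by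
  refine hS.dense.eq_zero_of_inner_right ℂ fun v hv => ?_
  have h := hS.norm_form_sq_le ⟨v, hv⟩ x
  rw [hx, mul_zero] at h
  have h2 : ‖⟪v, S x⟫_ℂ‖ = 0 := pow_eq_zero_iff two_ne_zero |>.1 (le_antisymm h (sq_nonneg _))
  exact norm_eq_zero.1 h2

/-- A sequence that is Cauchy in the form is eventually bounded in the form. -/
theorem IsNonnegSymmetric.exists_form_bound (hS : IsNonnegSymmetric S) {u : ℕ → S.domain}
    (hu : Tendsto (fun p : ℕ × ℕ => (⟪((u p.1 - u p.2 : S.domain) : H), S (u p.1 - u p.2)⟫_ℂ).re)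
      atTop (𝓝 0)) :
    ∃ C, 0 ≤ C ∧ ∀ᶠ n in atTop, (⟪(u n : H), S (u n)⟫_ℂ).re ≤ C := by
  obtain ⟨⟨N, M⟩, hN⟩ := eventually_atTop.1 (hu.eventually (gt_mem_nhds zero_lt_one))
  refine ⟨2 * 1 + 2 * (⟪(u M : H), S (u M)⟫_ℂ).re, by linarith [hS.nonneg (u M)],
    eventually_atTop.2 ⟨N, fun n hn => ?_⟩⟩
  have h1 := hN (n, M) ⟨hn, le_rfl⟩
  have h2 := hS.form_add_le (u n - u M) (u M)
  rw [sub_add_cancel] at h2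
  linarith

variable [CompleteSpace H]

theorem IsNonnegSymmetric.adjoint_inner (hS : IsNonnegSymmetric S) (x : S†.domain) (y : S.domain) :
    ⟪S† x, (y : H)⟫_ℂ = ⟪(x : H), S y⟫_ℂ :=
  LinearPMap.adjoint_isFormalAdjoint hS.dense x y

/-- On `D[S] ∩ D(S*)` the form of `S*` is the limit of the form of `S`. -/
theorem IsNonnegSymmetric.tendsto_form (hS : IsNonnegSymmetric S) (x : S†.domain)
    {u : ℕ → S.domain} (hux : Tendsto (fun n => (u n : H)) atTop (𝓝 x))
    (hu : Tendsto (fun p : ℕ × ℕ => (⟪((u p.1 - u p.2 : S.domain) : H), S (u p.1 - u p.2)⟫_ℂ).re)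
      atTop (𝓝 0)) :
    Tendsto (fun n => ⟪(u n : H), S (u n)⟫_ℂ) atTop (𝓝 ⟪S† x, (x : H)⟫_ℂ) := by
  obtain ⟨C, hC0, hC⟩ := hS.exists_form_bound hu
  have h1 : Tendsto (fun n => ⟪(x : H), S (u n)⟫_ℂ) atTop (𝓝 ⟪S† x, (x : H)⟫_ℂ) := by
    simp_rw [← hS.adjoint_inner]
    exact tendsto_const_nhds.inner hux
  -- Cauchy–Schwarz controls `(u m - u n, S (u n))` uniformly in large `m`; with `n` fixed, `m → ∞`
  -- needs only convergence in `H`.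
  have h2 : Tendsto (fun n => ⟪(x : H) - u n, S (u n)⟫_ℂ) atTop (𝓝 0) := by
    rw [tendsto_zero_iff_norm_tendsto_zero, Metric.tendsto_atTop]
    intro ε hε
    -- Chosen so that the product with the form bound is at most `(ε / 2)²`; `C + 1` avoids a zero
    -- denominator.
    have hδ : 0 < ε ^ 2 / (4 * (C + 1)) := by positivity
    obtain ⟨⟨N, M⟩, hN⟩ := eventually_atTop.1 (hu.eventually (gt_mem_nhds hδ))
    obtain ⟨K, hK⟩ := eventually_atTop.1 hC
    refine ⟨max M K, fun n hn => ?_⟩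
    have hle : ‖⟪(x : H) - u n, S (u n)⟫_ℂ‖ ≤ ε / 2 := by
      have ht : Tendsto (fun m => ‖⟪(u m : H) - u n, S (u n)⟫_ℂ‖) atTop
          (𝓝 ‖⟪(x : H) - u n, S (u n)⟫_ℂ‖) :=
        ((hux.sub_const _).inner tendsto_const_nhds).norm
      refine le_of_tendsto ht (eventually_atTop.2 ⟨N, fun m hm => ?_⟩)
      have a1 := hN (m, n) ⟨hm, (le_max_left _ _).trans hn⟩
      have a2 := hK n ((le_max_right _ _).trans hn)
      have a3 := hS.norm_form_sq_le (u m - u n) (u n)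
      have a4 : (⟪((u m - u n : S.domain) : H), S (u m - u n)⟫_ℂ).re *
          (⟪(u n : H), S (u n)⟫_ℂ).re ≤ (ε ^ 2 / (4 * (C + 1))) * (C + 1) :=
        mul_le_mul a1.le (by linarith) (hS.nonneg _) hδ.le
      have a5 : (ε ^ 2 / (4 * (C + 1))) * (C + 1) = (ε / 2) ^ 2 := by field_simp; norm_num
      have a6 := a3.trans (a4.trans_eq a5)
      exact abs_le_of_sq_le_sq' a6 (by positivity) |>.2
    rw [dist_zero_right, norm_norm]
    linarith
  have h3 := h1.sub h2
  rw [sub_zero] at h3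
  refine h3.congr fun n => ?_
  rw [inner_sub_left, sub_sub_cancel]

theorem friedrichs_apply (hS : IsNonnegSymmetric S) (x : (friedrichs hS).domain) :
    friedrichs hS x = S† ⟨x, x.2.2⟩ := rfl

theorem friedrichs_form (hS : IsNonnegSymmetric S) (x : (friedrichs hS).domain) :
    ∃ r : ℝ, 0 ≤ r ∧ ⟪friedrichs hS x, (x : H)⟫_ℂ = r := by
  obtain ⟨u, hu, hu'⟩ := x.2.1
  have h := hS.tendsto_form ⟨x, x.2.2⟩ hu hu'
  refine ⟨(⟪friedrichs hS x, (x : H)⟫_ℂ).re, ?_, Complex.ext rfl ?_⟩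
  · exact ge_of_tendsto' ((Complex.continuous_re.tendsto _).comp h) fun n => hS.nonneg _
  · refine tendsto_nhds_unique ((Complex.continuous_im.tendsto _).comp h) ?_
    refine tendsto_const_nhds.congr fun n => ?_
    exact (hS.form_im _).symm

/-- The Friedrichs extension is densely defined, symmetric and nonnegative. -/
theorem isNonnegSymmetric_friedrichs (hS : IsNonnegSymmetric S) :
    IsNonnegSymmetric (friedrichs hS) where
  dense := hS.dense.mono (le_friedrichs hS).1
  symm x y := by
    -- The quadratic form is real, so polarization with `x + y` and `x + I y` yields symmetry.
    have key : ∀ z : (friedrichs hS).domain,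
        ⟪friedrichs hS z, (z : H)⟫_ℂ - ⟪(z : H), friedrichs hS z⟫_ℂ = 0 := by
      intro z
      obtain ⟨r, -, hr⟩ := friedrichs_form hS z
      rw [← inner_conj_symm (z : H), hr, Complex.conj_ofReal, sub_self]
    have h1 := key (x + y)
    have h2 := key (x + Complex.I • y)
    have hx := key x
    have hy := key y
    simp only [LinearPMap.map_add, LinearPMap.map_smul, Submodule.coe_add, Submodule.coe_smul,
      inner_add_left, inner_add_right, inner_smul_left, inner_smul_right, Complex.conj_I] at h1 h2
    have h3 := congrArg (fun z => -Complex.I * z) h2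
    have hI := Complex.I_mul_I
    simp only [mul_zero] at h3
    rw [← sub_eq_zero]
    linear_combination (1 / 2) * h1 + (1 / 2) * h3 + (-1 / 2 + Complex.I / 2) * hx +
      (-1 / 2 - Complex.I ^ 3 / 2) * hy + (1 / 2) * (⟪friedrichs hS x, (y : H)⟫_ℂ -
        ⟪friedrichs hS y, (x : H)⟫_ℂ - ⟪(x : H), friedrichs hS y⟫_ℂ + ⟪(y : H), friedrichs hS x⟫_ℂ) * hI
  nonneg x := by
    obtain ⟨r, hr, hx⟩ := friedrichs_form hS x
    rw [← inner_conj_symm, hx]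
    simpa using hr

/-- Elements of the Friedrichs domain are approximable in the form by elements of `D(S)`. -/
theorem exists_friedrichs_form_sub_lt (hS : IsNonnegSymmetric S) (x : (friedrichs hS).domain)
    {ε : ℝ} (hε : 0 < ε) :
    ∃ y : (friedrichs hS).domain, (y : H) ∈ S.domain ∧
      (⟪((x - y : (friedrichs hS).domain) : H), friedrichs hS (x - y)⟫_ℂ).re < ε := by
  obtain ⟨u, hu, hu'⟩ := x.2.1
  -- Half of `ε`, because the strict inequality becomes weak in the limit.
  obtain ⟨⟨N, M⟩, hN⟩ := eventually_atTop.1 (hu'.eventually (gt_mem_nhds (half_pos hε)))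
  refine ⟨⟨u M, (le_friedrichs hS).1 (u M).2⟩, (u M).2, ?_⟩
  set y : (friedrichs hS).domain := ⟨u M, (le_friedrichs hS).1 (u M).2⟩
  have h1 : Tendsto (fun n => ((u n - u M : S.domain) : H)) atTop
      (𝓝 ((⟨(x - y : (friedrichs hS).domain), (x - y).2.2⟩ : S†.domain) : H)) := by
    simpa using hu.sub_const (u M : H)
  have h2 := hS.tendsto_form _ h1 (by simpa using hu')
  have h3 : (⟪friedrichs hS (x - y), ((x - y : (friedrichs hS).domain) : H)⟫_ℂ).re ≤ ε / 2 :=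
    le_of_tendsto ((Complex.continuous_re.tendsto _).comp h2)
      (eventually_atTop.2 ⟨N, fun n hn => (hN (n, M) ⟨hn, le_rfl⟩).le⟩)
  rw [(isNonnegSymmetric_friedrichs hS).symm] at h3
  linarith

end Form

/-! ### Surjectivity of `I + S_F` and self-adjointness -/

section Resolvent

variable {S : H →ₗ.[ℂ] H}

/-- The domain of `S`, to be endowed with the inner product `(x, y) + (S x, y)`. -/
def FormSpace (_hS : IsNonnegSymmetric S) : Type _ := S.domain

variable (hS : IsNonnegSymmetric S)

instance : AddCommGroup (FormSpace hS) := inferInstanceAs (AddCommGroup S.domain)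

instance : Module ℂ (FormSpace hS) := inferInstanceAs (Module ℂ S.domain)

/-- The inner product `(x, y) + (S x, y)` on the domain of `S`. -/
@[reducible] def formSpaceCore : InnerProductSpace.Core ℂ (FormSpace hS) where
  inner x y := ⟪Submodule.subtype S.domain x, Submodule.subtype S.domain y⟫_ℂ +
    ⟪Submodule.subtype S.domain x, S (y : S.domain)⟫_ℂ
  conj_inner_symm := by
    intro (x : S.domain) (y : S.domain)
    rw [map_add, inner_conj_symm, inner_conj_symm]
    exact congrArg₂ _ rfl (hS.symm x y)
  re_inner_nonneg := by
    intro (x : S.domain)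
    rw [map_add]
    exact add_nonneg inner_self_nonneg (hS.nonneg x)
  add_left := by
    intro (x : S.domain) (y : S.domain) (z : S.domain)
    have h1 := inner_add_left (𝕜 := ℂ) (x : H) (y : H) (z : H)
    have h2 := inner_add_left (𝕜 := ℂ) (x : H) (y : H) (S z)
    change ⟪(x : H) + y, (z : H)⟫_ℂ + ⟪(x : H) + y, S z⟫_ℂ = _
    rw [h1, h2]
    exact add_add_add_comm _ _ _ _
  smul_left := by
    intro (x : S.domain) (y : S.domain) r
    change ⟪r • (x : H), (y : H)⟫_ℂ + ⟪r • (x : H), S y⟫_ℂ = _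
    rw [inner_smul_left, inner_smul_left, ← mul_add]
    rfl
  definite := by
    intro (x : S.domain) hx
    have h1 : ⟪(x : H), (x : H)⟫_ℂ + ⟪(x : H), S x⟫_ℂ = 0 := hx
    have h2 := congrArg Complex.re h1
    have h3 : 0 ≤ (⟪(x : H), (x : H)⟫_ℂ).re := inner_self_nonneg (𝕜 := ℂ)
    rw [Complex.add_re, Complex.zero_re] at h2
    have h4 : (⟪(x : H), (x : H)⟫_ℂ).re = 0 := by linarith [hS.nonneg x]
    exact Subtype.ext (re_inner_self_nonpos (𝕜 := ℂ).1 h4.le)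

instance : NormedAddCommGroup (FormSpace hS) :=
  (formSpaceCore hS).toNormedAddCommGroup

instance : InnerProductSpace ℂ (FormSpace hS) :=
  InnerProductSpace.ofCore (formSpaceCore hS).toCore

/-- The inclusion of `D(S)` with the form norm into `H`. -/
def FormSpace.incl : FormSpace hS →ₗ[ℂ] H := Submodule.subtype S.domain

theorem FormSpace.inner_def (x y : FormSpace hS) :
    ⟪x, y⟫_ℂ = ⟪incl hS x, incl hS y⟫_ℂ + ⟪incl hS x, S (y : S.domain)⟫_ℂ := rfl

theorem FormSpace.norm_sq (x : FormSpace hS) :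
    ‖x‖ ^ 2 = ‖incl hS x‖ ^ 2 + (⟪incl hS x, S (x : S.domain)⟫_ℂ).re := by
  rw [← inner_self_eq_norm_sq (𝕜 := ℂ), FormSpace.inner_def, map_add,
    inner_self_eq_norm_sq (𝕜 := ℂ)]
  rfl

theorem FormSpace.norm_incl_le (x : FormSpace hS) : ‖incl hS x‖ ≤ ‖x‖ := by
  have h := FormSpace.norm_sq hS x
  have h2 : 0 ≤ (⟪incl hS x, S (x : S.domain)⟫_ℂ).re := hS.nonneg x
  exact abs_le_of_sq_le_sq' (by linarith) (norm_nonneg _) |>.2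

theorem FormSpace.form_le (x : FormSpace hS) :
    (⟪incl hS x, S (x : S.domain)⟫_ℂ).re ≤ ‖x‖ ^ 2 := by
  rw [FormSpace.norm_sq hS x]
  linarith [sq_nonneg ‖incl hS x‖]

variable [CompleteSpace H]

/-- The functional `v ↦ (v, y)` is bounded in the form norm, so it has a Riesz representative in the
completion of the form space. The limit in `H` of a sequence from `D(S)` approximating this
representative is the solution. -/
theorem friedrichs_add_id_surjective (y : H) :
    ∃ x : (friedrichs hS).domain, (x : H) + friedrichs hS x = y := by
  let φ : FormSpace hS →L[ℂ] ℂ :=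
    ((innerₛₗ ℂ y).comp (FormSpace.incl hS)).mkContinuous ‖y‖ fun x =>
      (norm_inner_le_norm _ _).trans
        (mul_le_mul_of_nonneg_left (FormSpace.norm_incl_le hS x) (norm_nonneg _))
  let ι : FormSpace hS →L[ℂ] UniformSpace.Completion (FormSpace hS) :=
    UniformSpace.Completion.toComplL
  have hd : DenseRange ι := UniformSpace.Completion.denseRange_coe
  have hu : IsUniformInducing ι := UniformSpace.Completion.isUniformInducing_coe _
  let e := (InnerProductSpace.toDual ℂ _).symm (φ.extend ι)
  have he : ∀ v : FormSpace hS, ⟪e, ι v⟫_ℂ = ⟪y, FormSpace.incl hS v⟫_ℂ := by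
    intro v
    rw [InnerProductSpace.toDual_symm_apply, ContinuousLinearMap.extend_eq φ hd hu]
    rfl
  obtain ⟨w, hw, hwe⟩ := mem_closure_iff_seq_limit.1 (hd e)
  choose u hu' using hw
  have hue : Tendsto (fun n => ι (u n)) atTop (𝓝 e) := by simpa only [hu'] using hwe
  have hι : ∀ v, ‖ι v‖ = ‖v‖ := UniformSpace.Completion.norm_coe
  have hpair : Tendsto (fun p : ℕ × ℕ => ‖u p.1 - u p.2‖ ^ 2) atTop (𝓝 0) := by
    have h1 : Tendsto (fun p : ℕ × ℕ => ι (u p.1) - ι (u p.2)) atTop (𝓝 (e - e)) := by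
      rw [← prod_atTop_atTop_eq]
      exact (hue.comp tendsto_fst).sub (hue.comp tendsto_snd)
    have h2 := (h1.norm).pow 2
    simpa [← map_sub, hι] using h2
  have hcauchy' : CauchySeq (fun n => FormSpace.incl hS (u n)) := by
    rw [Metric.cauchySeq_iff]
    intro ε hε
    obtain ⟨N, hN⟩ := Metric.cauchySeq_iff.1 hue.cauchySeq ε hε
    refine ⟨N, fun m hm n hn => lt_of_le_of_lt ?_ (hN m hm n hn)⟩
    rw [dist_eq_norm, dist_eq_norm, ← map_sub, ← map_sub, hι]
    exact FormSpace.norm_incl_le hS _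
  obtain ⟨x, hx⟩ := cauchySeq_tendsto_of_complete hcauchy'
  have hform : x ∈ formDomain hS :=
    ⟨u, hx, squeeze_zero (fun p => hS.nonneg _) (fun p => FormSpace.form_le hS (u p.1 - u p.2)) hpair⟩
  -- Two evaluations of the limit of the form inner products of `u n` with `v`; this says `S* x = y
  -- - x`.
  have hadj : ∀ v : S.domain, ⟪y - x, (v : H)⟫_ℂ = ⟪x, S v⟫_ℂ := by
    intro v
    have h1 : Tendsto (fun n => ⟪ι (u n), ι v⟫_ℂ) atTop (𝓝 ⟪y, (v : H)⟫_ℂ) := by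
      have := he v
      rw [show ⟪y, (v : H)⟫_ℂ = ⟪e, ι v⟫_ℂ from this.symm]
      exact hue.inner tendsto_const_nhds
    have h2 : Tendsto (fun n => ⟪ι (u n), ι v⟫_ℂ) atTop (𝓝 (⟪x, (v : H)⟫_ℂ + ⟪x, S v⟫_ℂ)) := by
      refine ((hx.inner tendsto_const_nhds).add (hx.inner tendsto_const_nhds)).congr fun n => ?_
      exact (UniformSpace.Completion.inner_coe (𝕜 := ℂ) (E := FormSpace hS) (u n) v).symm
    rw [inner_sub_left, tendsto_nhds_unique h1 h2, add_sub_cancel_left]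
  have hdom : x ∈ S†.domain := LinearPMap.mem_adjoint_domain_of_exists _ ⟨_, hadj⟩
  refine ⟨⟨x, hform, hdom⟩, ?_⟩
  rw [friedrichs_apply, LinearPMap.adjoint_apply_eq hS.dense ⟨x, hdom⟩ hadj]
  exact add_sub_cancel _ _

/-- A symmetric operator `A` for which `I + A` is onto is self-adjoint. -/
theorem IsNonnegSymmetric.isSelfAdjoint {A : H →ₗ.[ℂ] H} (hA : IsNonnegSymmetric A)
    (hsurj : ∀ y : H, ∃ x : A.domain, (x : H) + A x = y) : IsSelfAdjoint A := by
  rw [LinearPMap.isSelfAdjoint_def]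
  have hle : A ≤ A† := LinearPMap.IsFormalAdjoint.le_adjoint hA.dense fun x y => hA.symm x y
  refine (LinearPMap.eq_of_le_of_domain_eq hle (le_antisymm hle.1 fun z hz => ?_)).symm
  -- Now `z - x` is killed by `I + A*`, hence orthogonal to the range of `I + A`, which contains `z
  -- - x` itself.
  obtain ⟨x, hx⟩ := hsurj (z + A† ⟨z, hz⟩)
  obtain ⟨v, hv⟩ := hsurj (z - x)
  have hxv : ⟪(x : H), A v⟫_ℂ = ⟪A x, (v : H)⟫_ℂ := (hA.symm x v).symm
  have hzv : ⟪z, A v⟫_ℂ = ⟪A† ⟨z, hz⟩, (v : H)⟫_ℂ := (hA.adjoint_inner ⟨z, hz⟩ v).symm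
  have h0 : ⟪z - x, z - x⟫_ℂ = 0 := by
    nth_rewrite 2 [← hv]
    rw [inner_add_right, inner_sub_left, inner_sub_left, hxv, hzv]
    have h1 : ⟪(x : H), (v : H)⟫_ℂ + ⟪A x, (v : H)⟫_ℂ =
        ⟪z, (v : H)⟫_ℂ + ⟪A† ⟨z, hz⟩, (v : H)⟫_ℂ := by
      rw [← inner_add_left, ← inner_add_left, hx]
    linear_combination -h1
  rw [sub_eq_zero.1 (inner_self_eq_zero.1 h0)]
  exact x.2

theorem isSelfAdjoint_friedrichs : IsSelfAdjoint (friedrichs hS) :=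
  (isNonnegSymmetric_friedrichs hS).isSelfAdjoint (friedrichs_add_id_surjective hS)

end Resolvent

/-! ### Functionals bounded in the form, and the Krein condition -/

/-- If `b ∈ D[S]`, the functional `x ↦ (S x, b)` is bounded in the form of `S`. -/
theorem exists_bound_of_mem_formDomain {S : H →ₗ.[ℂ] H} (hS : IsNonnegSymmetric S) {b : H}
    (hb : b ∈ formDomain hS) :
    ∃ C, ∀ x : S.domain, ‖⟪b, S x⟫_ℂ‖ ^ 2 ≤ C * (⟪(x : H), S x⟫_ℂ).re := by
  obtain ⟨u, hu, hu'⟩ := hb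
  obtain ⟨C, -, hC⟩ := hS.exists_form_bound hu'
  refine ⟨C, fun x => ?_⟩
  refine le_of_tendsto ((hu.inner tendsto_const_nhds).norm.pow 2) (hC.mono fun n hn => ?_)
  exact (hS.norm_form_sq_le (u n) x).trans (mul_le_mul_of_nonneg_right hn (hS.nonneg x))

/-- Under the Krein condition, no nonzero `g ∈ ker (I + S*)` gives a functional `x ↦ (S x, g)`
that is bounded in the form of `S`. -/
theorem KreinCondition.eq_zero [CompleteSpace H] {S : H →ₗ.[ℂ] H} (hK : KreinCondition S)
    (hS : IsNonnegSymmetric S) (hpos : ∀ x : S.domain, S x = 0 → x = 0)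
    (g : S†.domain) (hg : (g : H) + S† g = 0) {C : ℝ}
    (hC : ∀ x : S.domain, ‖⟪(g : H), S x⟫_ℂ‖ ^ 2 ≤ C * (⟪(x : H), S x⟫_ℂ).re) : g = 0 := by
  by_contra hne
  have h0 := hK g hne hg
  -- The maximum with `1` makes `1 / D` a positive lower bound whatever the sign of `C`.
  set D : ℝ := max C 1
  have hD : 0 < D := lt_max_of_lt_right one_pos
  have hlow : ENNReal.ofReal (1 / D) ≤ ⨅ (x : S.domain) (_ : x ≠ 0),
      ENNReal.ofReal (⟪(x : H), S x⟫_ℂ).re / ENNReal.ofReal (‖⟪(g : H), (x : H)⟫_ℂ‖ ^ 2) := by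
    refine le_iInf₂ fun x hx => ?_
    have hq : 0 < (⟪(x : H), S x⟫_ℂ).re :=
      lt_of_le_of_ne (hS.nonneg x) fun h => hx (hpos x (hS.apply_eq_zero h.symm))
    -- The numerator is nonzero, so the case `(x, g) = 0` of a vanishing denominator is covered as
    -- well.
    rw [ENNReal.le_div_iff_mul_le (Or.inr (by simpa using hq)) (Or.inr ENNReal.ofReal_ne_top),
      ← ENNReal.ofReal_mul (by positivity)]
    refine ENNReal.ofReal_le_ofReal ?_
    have h1 : ⟪(g : H), (x : H)⟫_ℂ = -⟪(g : H), S x⟫_ℂ := by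
      rw [← hS.adjoint_inner, ← add_eq_zero_iff_eq_neg, ← inner_add_left, hg, inner_zero_left]
    rw [h1, norm_neg, one_div, inv_mul_le_iff₀ hD]
    exact (hC x).trans (mul_le_mul_of_nonneg_right (le_max_left _ _) hq.le)
  rw [h0] at hlow
  have : (0 : ℝ) < 1 / D := by positivity
  exact absurd hlow (by simpa using hD)

/-! ### The operator `J G_F` as an operator of `𝒞`-symmetry -/

namespace IsCompleteEigensystem

variable {J : H →L[ℂ] H} {T : H →ₗ.[ℂ] H} {ev : ℕ → ℝ} {f : ℕ → H}

theorem G₀_apply (h : IsCompleteEigensystem J T ev f) {a b : H} (ha : a ∈ posSpan J f)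
    (hb : b ∈ negSpan J f) (x : h.G₀.domain) (hx : (x : H) = a + b) : h.G₀ x = J (a - b) := by
  have h1 : h.C₀ x = a + -b :=
    LinearPMap.sup_apply
      (f := ⟨posSpan J f, (posSpan J f).subtype⟩) (g := ⟨negSpan J f, -(negSpan J f).subtype⟩)
      (LinearPMap.sup_h_of_disjoint _ _ h.disjoint) ⟨a, ha⟩ ⟨b, hb⟩ x hx.symm
  change J (h.C₀ x) = _
  rw [h1, ← sub_eq_add_neg]

/-- `J G₀` maps `D(G₀)` into itself, and `G₀ J G₀ = J`. -/
theorem exists_G₀_apply_eq (h : IsCompleteEigensystem J T ev f) (x : h.G₀.domain) :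
    ∃ y : h.G₀.domain, (y : H) = J (h.G₀ x) ∧ h.G₀ y = J x := by
  obtain ⟨a, ha, b, hb, hx, hGx⟩ := h.exists_decomp x
  have hmem : a + -b ∈ posSpan J f ⊔ negSpan J f :=
    Submodule.add_mem_sup ha (neg_mem hb)
  refine ⟨⟨a + -b, hmem⟩, ?_, ?_⟩
  · rw [hGx, map_sub, h.fundamental.involutive, h.fundamental.involutive, sub_eq_add_neg]
  · rw [h.G₀_apply ha (neg_mem hb) ⟨a + -b, hmem⟩ rfl, sub_neg_eq_add, hx]

/-- The identity `G₀ J G₀ = J` forces `J x = 0`. -/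
theorem G₀_injective (h : IsCompleteEigensystem J T ev f) (x : h.G₀.domain) (hx : h.G₀ x = 0) :
    x = 0 := by
  obtain ⟨y, hy, hGy⟩ := h.exists_G₀_apply_eq x
  rw [hx, map_zero] at hy
  have hy0 : y = 0 := Subtype.ext hy
  rw [hy0, LinearPMap.map_zero] at hGy
  refine Subtype.ext ?_
  rw [← h.fundamental.involutive x, ← hGy, map_zero]
  rfl

variable [CompleteSpace H]

theorem GF_apply_G₀ (h : IsCompleteEigensystem J T ev f) (x : h.GF.domain) (y : h.G₀.domain)
    (hxy : (x : H) = y) : h.GF x = h.G₀ y :=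
  ((le_friedrichs h.isNonnegSymmetric_G₀).2 hxy.symm).symm

theorem isNonnegSymmetric_GF (h : IsCompleteEigensystem J T ev f) : IsNonnegSymmetric h.GF :=
  isNonnegSymmetric_friedrichs _

/-- Under the Krein condition `G_F` coincides with its transform `J G_F⁻¹ J`. -/
theorem exists_GF_apply_eq (h : IsCompleteEigensystem J T ev f) (hK : KreinCondition h.G₀)
    (b : h.GF.domain) : ∃ w : h.GF.domain, (w : H) = J (h.GF b) ∧ h.GF w = J b := by
  have hS := h.isNonnegSymmetric_G₀
  have hJ := h.fundamental
  -- The expected solution is `w = J G_F b` with `G_F w = J b`, whose sum is this right-hand side.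
  obtain ⟨w, hw⟩ := friedrichs_add_id_surjective hS (J ((b : H) + h.GF b))
  change h.GF.domain at w
  change (w : H) + h.GF w = J ((b : H) + h.GF b) at hw
  -- Take `v = J G₀ x`: it has the same form value as `x` and moves pairings with `J G_F w` into the
  -- form of `G_F`, where Cauchy–Schwarz applies.
  have haux : ∀ x : h.G₀.domain, ∃ v : h.GF.domain, h.GF v = J x ∧
      ⟪(v : H), h.GF v⟫_ℂ = ⟪(x : H), h.G₀ x⟫_ℂ ∧
      ⟪J (h.GF w), h.G₀ x⟫_ℂ = ⟪(w : H), h.GF v⟫_ℂ := by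
    intro x
    obtain ⟨y, hy, hGy⟩ := h.exists_G₀_apply_eq x
    have hv := h.GF_apply_G₀ ⟨y, (le_friedrichs hS).1 y.2⟩ y rfl
    refine ⟨⟨y, (le_friedrichs hS).1 y.2⟩, hv.trans hGy, ?_, ?_⟩
    · rw [hv, hGy]
      change ⟪(y : H), J x⟫_ℂ = _
      rw [hy, hJ.selfAdjoint, hJ.involutive]
      exact hS.symm x x
    · rw [hJ.selfAdjoint, ← hy]
      exact h.isNonnegSymmetric_GF.symm w ⟨y, (le_friedrichs hS).1 y.2⟩
  have hadj : ∀ x : h.G₀.domain, ⟪J w, (x : H)⟫_ℂ = ⟪J (h.GF w), h.G₀ x⟫_ℂ := by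
    intro x
    obtain ⟨v, hv, -, hv'⟩ := haux x
    rw [hv', hv, hJ.selfAdjoint]
  have ha : J (h.GF w) ∈ h.G₀†.domain := LinearPMap.mem_adjoint_domain_of_exists _ ⟨_, hadj⟩
  have hGa : h.G₀† ⟨_, ha⟩ = J w := LinearPMap.adjoint_apply_eq hS.dense _ hadj
  have hb : h.G₀† ⟨b, b.2.2⟩ = h.GF b := rfl
  have hsum : J (h.GF w) + J w = b + h.GF b := by
    rw [← map_add, add_comm, hw, hJ.involutive]
  obtain ⟨C, hC⟩ := exists_bound_of_mem_formDomain hS b.2.1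
  -- The constant comes from `|p - q|² ≤ 2 |p|² + 2 |q|²`: the first part is bounded by the form
  -- value of `w`, the second because `b ∈ D[G₀]`.
  have hbound : ∀ x : h.G₀.domain, ‖⟪J (h.GF w) - b, h.G₀ x⟫_ℂ‖ ^ 2 ≤
      (2 * (⟪(w : H), h.GF w⟫_ℂ).re + 2 * C) * (⟪(x : H), h.G₀ x⟫_ℂ).re := by
    intro x
    obtain ⟨v, -, hv1, hv2⟩ := haux x
    have c1 : ‖⟪J (h.GF w), h.G₀ x⟫_ℂ‖ ^ 2 ≤
        (⟪(w : H), h.GF w⟫_ℂ).re * (⟪(x : H), h.G₀ x⟫_ℂ).re := by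
      rw [hv2, ← hv1]
      exact h.isNonnegSymmetric_GF.norm_form_sq_le w v
    have c2 := hC x
    have c3 := norm_sub_le ⟪J (h.GF w), h.G₀ x⟫_ℂ ⟪(b : H), h.G₀ x⟫_ℂ
    rw [inner_sub_left]
    have c4 := pow_le_pow_left₀ (norm_nonneg _) c3 2
    have c5 := sq_nonneg (‖⟪J (h.GF w), h.G₀ x⟫_ℂ‖ - ‖⟪(b : H), h.G₀ x⟫_ℂ‖)
    linarith
  have hzero := hK.eq_zero hS h.G₀_injective (⟨_, ha⟩ - ⟨b, b.2.2⟩) (by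
    rw [LinearPMap.map_sub, hGa, hb]
    change J (h.GF w) - b + _ = 0
    rw [sub_add_sub_comm, hsum, sub_self]) hbound
  have heq : J (h.GF w) = b := congrArg Subtype.val (sub_eq_zero.1 hzero)
  refine ⟨w, ?_, ?_⟩
  · rw [heq] at hsum
    rw [← add_left_cancel hsum, hJ.involutive]
  · rw [← heq, hJ.involutive]

theorem leftMul_CF (h : IsCompleteEigensystem J T ev f) : leftMul J h.CF = h.GF := by
  refine LinearPMap.ext rfl fun x hx hx' => ?_
  exact h.fundamental.involutive _

theorem C₀_le_CF (h : IsCompleteEigensystem J T ev f) : h.C₀ ≤ h.CF := by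
  have hle := le_friedrichs h.isNonnegSymmetric_G₀
  refine ⟨hle.1, fun x y hxy => ?_⟩
  have h1 : J (h.C₀ x) = h.GF y := hle.2 (x := x) (y := y) hxy
  change _ = J (h.GF y)
  rw [← h1, h.fundamental.involutive]

/-- The Krein condition enters through `exists_GF_apply_eq`, which gives the involution and also the
injectivity of `G_F` needed for strict positivity. -/
theorem isCOperator_CF (h : IsCompleteEigensystem J T ev f) (hK : KreinCondition h.G₀) :
    IsCOperator J h.CF where
  mapsTo x := by
    obtain ⟨w, hw, -⟩ := h.exists_GF_apply_eq hK x
    change J (h.GF x) ∈ h.GF.domain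
    rw [← hw]
    exact w.2
  sq_eq x := by
    obtain ⟨w, hw, hGw⟩ := h.exists_GF_apply_eq hK x
    -- Quantifying over the membership proof lets `J (h.GF x)` be rewritten as `w` inside the
    -- subtype.
    have hx : ∀ hm : J (h.GF x) ∈ h.GF.domain, J (h.GF ⟨J (h.GF x), hm⟩) = x := by
      rw [← hw]
      intro hm
      exact (congrArg J hGw).trans (h.fundamental.involutive _)
    exact hx _
  selfAdjoint := by
    rw [leftMul_CF]
    exact isSelfAdjoint_friedrichs _
  positive x hx := by
    change 0 < (⟪(x : H), J (J (h.GF x))⟫_ℂ).re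
    rw [h.fundamental.involutive]
    refine lt_of_le_of_ne (h.isNonnegSymmetric_GF.nonneg x) fun h0 => hx (Subtype.ext ?_)
    have hG := h.isNonnegSymmetric_GF.apply_eq_zero h0.symm
    obtain ⟨w, hw, hGw⟩ := h.exists_GF_apply_eq hK x
    rw [hG, map_zero] at hw
    have hw0 : w = 0 := Subtype.ext hw
    rw [hw0, LinearPMap.map_zero] at hGw
    rw [← h.fundamental.involutive x, ← hGw, map_zero]
    rfl

/-! ### Density of the eigenvectors in the form of `G_F` and in `ℌ_C` -/

/-- Every vector of `D(G_F)` lying in the closure of the span of a set of eigenvectors on whose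
closed span `G_F` acts boundedly is approximable in the form of `G_F` by that span. -/
theorem exists_span_form_lt (h : IsCompleteEigensystem J T ev f) (B : H →L[ℂ] H) (s : Set ℕ)
    (hB : ∀ x : h.GF.domain, (x : H) ∈ (Submodule.span ℂ (f '' s)).topologicalClosure →
      h.GF x = B x)
    (x : h.GF.domain) (hx : (x : H) ∈ (Submodule.span ℂ (f '' s)).topologicalClosure)
    {ε : ℝ} (hε : 0 < ε) :
    ∃ y : h.GF.domain, (y : H) ∈ Submodule.span ℂ (Set.range f) ∧
      (⟪((x - y : h.GF.domain) : H), h.GF (x - y)⟫_ℂ).re < ε := by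
  have hcont : Continuous fun z : H => (⟪(x : H) - z, B (x - z)⟫_ℂ).re := by fun_prop
  -- With `B` in place of `G_F` the form is continuous on `H`, so this is a neighbourhood of `x` and
  -- meets the span.
  have hopen : IsOpen {z : H | (⟪(x : H) - z, B (x - z)⟫_ℂ).re < ε} :=
    isOpen_lt hcont continuous_const
  obtain ⟨z, hz, hzs⟩ := mem_closure_iff.1 (show (x : H) ∈ closure _ from hx) _ hopen
    (by simpa using hε)
  have hsub : Submodule.span ℂ (f '' s) ≤ h.GF.domain := by
    rw [Submodule.span_le]
    rintro _ ⟨n, -, rfl⟩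
    exact h.mem_domain_CF n
  refine ⟨⟨z, hsub hzs⟩, Submodule.span_mono (Set.image_subset_range _ _) hzs, ?_⟩
  rw [hB _ (sub_mem hx (Submodule.le_topologicalClosure _ hzs))]
  exact hz

/-- The span of the eigenvectors is dense in `D(G_F)` with respect to the form of `G_F`. -/
theorem exists_span_range_form_lt (h : IsCompleteEigensystem J T ev f) (x : h.GF.domain)
    {ε : ℝ} (hε : 0 < ε) :
    ∃ y : h.GF.domain, (y : H) ∈ Submodule.span ℂ (Set.range f) ∧
      (⟪((x - y : h.GF.domain) : H), h.GF (x - y)⟫_ℂ).re < ε := by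
  have hG := h.isNonnegSymmetric_GF
  have hle := le_friedrichs h.isNonnegSymmetric_G₀
  -- Splitting the error into three terms costs factors `2`, `4` and `4`, and `10 ε / 16 < ε`.
  obtain ⟨z, hz, hxz⟩ := exists_friedrichs_form_sub_lt h.isNonnegSymmetric_G₀ x
    (show 0 < ε / 16 by positivity)
  change h.GF.domain at z
  obtain ⟨a, ha, b, hb, hzab, -⟩ := h.exists_decomp ⟨z, hz⟩
  have haG : a ∈ h.G₀.domain := Submodule.mem_sup_left ha
  have hbG : b ∈ h.G₀.domain := Submodule.mem_sup_right hb
  obtain ⟨a', ha', haa'⟩ := h.exists_span_form_lt J _ (fun u hu => by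
    rw [h.GF_apply_G₀ u ⟨u, Submodule.mem_sup_left hu⟩ rfl,
      h.G₀_apply hu (zero_mem _) _ (add_zero _).symm, sub_zero]) ⟨a, hle.1 haG⟩ ha
    (show 0 < ε / 16 by positivity)
  obtain ⟨b', hb', hbb'⟩ := h.exists_span_form_lt (-J) _ (fun u hu => by
    rw [h.GF_apply_G₀ u ⟨u, Submodule.mem_sup_right hu⟩ rfl,
      h.G₀_apply (zero_mem _) hu _ (zero_add _).symm, zero_sub, map_neg]
    rfl) ⟨b, hle.1 hbG⟩ hb (show 0 < ε / 16 by positivity)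
  refine ⟨a' + b', add_mem ha' hb', ?_⟩
  have e : x - (a' + b') = (x - z) + ((⟨a, hle.1 haG⟩ - a') + (⟨b, hle.1 hbG⟩ - b')) := by
    refine Subtype.ext ?_
    change (x : H) - (a' + b') = (x - z) + ((a - a') + (b - b'))
    rw [show (z : H) = a + b from hzab]
    abel
  have key : ∀ p q r : h.GF.domain, (⟪(p : H), h.GF p⟫_ℂ).re < ε / 16 →
      (⟪(q : H), h.GF q⟫_ℂ).re < ε / 16 → (⟪(r : H), h.GF r⟫_ℂ).re < ε / 16 →
      (⟪((p + (q + r) : h.GF.domain) : H), h.GF (p + (q + r))⟫_ℂ).re < ε := by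
    intro p q r hp hq hr
    linarith [hG.form_add_le p (q + r), hG.form_add_le q r]
  rw [e]
  exact key _ _ _ hxz haa' hbb'

/-- The span of the eigenvectors is dense in `ℌ_C`. -/
theorem dense_span_toHilbertC (h : IsCompleteEigensystem J T ev f) (hC : IsCOperator J h.CF) :
    Dense (Submodule.span ℂ (Set.range fun n =>
      toHilbertC hC ⟨f n, h.mem_domain_CF n⟩) : Set (HilbertC hC)) := by
  let L : PreHilbert hC →ₗ[ℂ] HilbertC hC :=
    (UniformSpace.Completion.toComplL (𝕜 := ℂ) (E := PreHilbert hC)).toLinearMap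
  let V : Submodule ℂ (HilbertC hC) :=
    Submodule.span ℂ (Set.range fun n => toHilbertC hC ⟨f n, h.mem_domain_CF n⟩)
  have hmem : ∀ y : h.GF.domain, (y : H) ∈ Submodule.span ℂ (Set.range f) →
      L (show PreHilbert hC from y) ∈ V := by
    have hgen : Submodule.span ℂ (Set.range f) ≤
        (V.comap L).map (show PreHilbert hC →ₗ[ℂ] H from h.GF.domain.subtype) := by
      rw [Submodule.span_le]
      rintro _ ⟨n, rfl⟩
      exact ⟨(⟨f n, h.mem_domain_CF n⟩ : h.GF.domain), Submodule.subset_span ⟨n, rfl⟩, rfl⟩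
    intro y hy
    obtain ⟨z, hz, hzy⟩ := hgen hy
    have : (show PreHilbert hC from y) = z := Subtype.ext hzy.symm
    rw [this]
    exact hz
  have hnorm : ∀ x : h.GF.domain, ‖(show PreHilbert hC from x)‖ ^ 2 =
      (⟪(x : H), h.GF x⟫_ℂ).re := by
    intro x
    rw [← inner_self_eq_norm_sq (𝕜 := ℂ)]
    change (⟪(x : H), J (J (h.GF x))⟫_ℂ).re = _
    rw [h.fundamental.involutive]
  have hcl : ∀ x : PreHilbert hC, L x ∈ closure (V : Set (HilbertC hC)) := by
    intro x
    rw [Metric.mem_closure_iff]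
    intro ε hε
    -- The form is the square of the norm of `ℌ_C`, hence the tolerance `ε²`.
    obtain ⟨y, hy, hxy⟩ := h.exists_span_range_form_lt x (pow_pos hε 2)
    let y' : PreHilbert hC := y
    refine ⟨L y', hmem y hy, ?_⟩
    have e1 : ‖L (x - y')‖ = ‖x - y'‖ := UniformSpace.Completion.norm_coe _
    rw [dist_eq_norm, ← map_sub, e1]
    refine lt_of_pow_lt_pow_left₀ 2 hε.le ?_
    exact (hnorm _).trans_lt hxy
  intro x
  refine closure_minimal ?_ isClosed_closure
    (UniformSpace.Completion.denseRange_coe (α := PreHilbert hC) x)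
  rintro _ ⟨y, rfl⟩
  exact hcl y

end IsCompleteEigensystem

end KreinCSymmetry

end

theorem theorem4 {H : Type*} [NormedAddCommGroup H] [InnerProductSpace ℂ H] [CompleteSpace H]
    (J : H →L[ℂ] H) (T : H →ₗ.[ℂ] H) (ev : ℕ → ℝ) (f : ℕ → H)
    (h : KreinCSymmetry.IsCompleteEigensystem J T ev f)
    (hF : KreinCSymmetry.IsCOperator J h.CF ∨ KreinCSymmetry.KreinCondition h.G₀) :
    ∃ hC : KreinCSymmetry.IsCOperator J h.CF, h.C₀ ≤ h.CF ∧
      Dense (Submodule.span ℂ (Set.range fun n =>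
        KreinCSymmetry.toHilbertC hC ⟨f n, h.mem_domain_CF n⟩) :
          Set (KreinCSymmetry.HilbertC hC)) :=
  have hC : KreinCSymmetry.IsCOperator J h.CF := hF.elim id h.isCOperator_CF
  ⟨hC, h.C₀_le_CF, h.dense_span_toHilbertC hC⟩
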